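/- Let $M$ be a complex Kähler manifold (Hausdorff, second countable) of complex dimension $n\ge 1$, and let $\mathcal F$ be a singular holomorphic foliation of dimension one on $M$: a covering of $M$ by holomorphic charts $(U_k,\varphi_k)$ together with holomorphic vector fields $Y_k$ on $\varphi_k(U_k)\subset\mathbb C^n$, whose zero sets have codimension at least two, such that on each overlap $U_k\cap U_l$ one has (after identifying $Y_k$, $Y_l$ with vector fields on $U_k$, $U_l$) $Y_k=g_{kl}Y_l$ for some nowhere vanishing holomorphic function $g_{kl}$. Let $\mathrm{Sing}(\mathcal F)$ be the set of points of $M$ corresponding to zeros of the $Y_k$. The leaves of $\mathcal F$ are the leaves of the regular foliation it induces on $M\setminus\mathrm{Sing}(\mathcal F)$, and a leaf $L$ carries non-trivial holonomy if some loop in $L$ has a holonomy map, defined near the base point on a transversal to $\mathcal F$, whose germ at the base point is not the germ of the identity. Then the union in $M$ of all leaves of $\mathcal F$ carrying non-trivial holonomy has Hausdorff dimension at most $2n-2$ (real dimension, so that $M$ has dimension $2n$; measured in the holomorphic charts of $M$). In particular, this union has Lebesgue measure zero in $M$. -/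

import Mathlib

open scoped Manifold ContDiff Topology

/-- `ℂⁿ` with its Euclidean norm. -/
abbrev CSpace (n : ℕ) : Type := EuclideanSpace ℂ (Fin n)

/-! ### Kähler metrics -/

section Kahler

variable (n : ℕ) (M : Type*) [TopologicalSpace M] [ChartedSpace (CSpace n) M]

/-- A Kähler metric on a complex manifold of dimension `n`: a smooth positive definite Hermitian
form on the tangent spaces whose imaginary part is a closed `2`-form. -/
structure KahlerMetric where
  /-- The Hermitian form on `T_p M` (conjugate linear in the first variable). -/
  herm : (p : M) → TangentSpace 𝓘(ℂ, CSpace n) p →ₗ⋆[ℂ] TangentSpace 𝓘(ℂ, CSpace n) p →ₗ[ℂ] ℂ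
  hermitian : ∀ p v w, herm p v w = starRingEnd ℂ (herm p w v)
  pos : ∀ p v, v ≠ 0 → 0 < (herm p v v).re
  /-- The coefficients of the form in the charts of the atlas are smooth (in the real sense). -/
  smooth : ∀ ψ ∈ atlas (CSpace n) M, ∀ v w : CSpace n,
    ContDiffOn ℝ ∞ (fun z : CSpace n => herm (ψ.symm z)
      (mfderiv 𝓘(ℂ, CSpace n) 𝓘(ℂ, CSpace n) ψ.symm z v)
      (mfderiv 𝓘(ℂ, CSpace n) 𝓘(ℂ, CSpace n) ψ.symm z w)) ψ.target
  /-- The exterior derivative of the imaginary part vanishes. It is evaluated in each chart on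
  three constant (hence commuting) vector fields `u, v, w`. -/
  closed : ∀ ψ ∈ atlas (CSpace n) M, ∀ z ∈ ψ.target, ∀ u v w : CSpace n,
    let Ω : CSpace n → CSpace n → CSpace n → ℝ := fun a b x => (herm (ψ.symm x)
      (mfderiv 𝓘(ℂ, CSpace n) 𝓘(ℂ, CSpace n) ψ.symm x a)
      (mfderiv 𝓘(ℂ, CSpace n) 𝓘(ℂ, CSpace n) ψ.symm x b)).im
    fderiv ℝ (Ω v w) z u + fderiv ℝ (Ω w u) z v + fderiv ℝ (Ω u v) z w = 0

/-- The complex manifold `M` is Kähler. -/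
def IsKahler : Prop := Nonempty (KahlerMetric n M)

end Kahler

/-! ### Singular holomorphic foliations by curves -/

/-- A (locally) analytic subset `A` of `ℂⁿ` has codimension at least `2`: every (locally immersed)
complex submanifold contained in `A` has dimension `d ≤ n - 2`. -/
def CodimAtLeastTwo {n : ℕ} (A : Set (CSpace n)) : Prop :=
  ∀ (d : ℕ) (U : Set (CSpace d)) (f : CSpace d → CSpace n), IsOpen U → U.Nonempty →
    DifferentiableOn ℂ f U → (∀ z ∈ U, Function.Injective (fderiv ℂ f z)) →
    Set.MapsTo f U A → d + 2 ≤ n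

/-- A singular holomorphic foliation of dimension one on a complex manifold `M` of dimension `n`:
a covering by holomorphic charts together with holomorphic vector fields on (the images of) the
chart domains, with singular sets of codimension at least two, which agree on overlaps up to
multiplication by nowhere vanishing holomorphic functions. -/
structure HolFoliation (n : ℕ) (M : Type*) [TopologicalSpace M] [ChartedSpace (CSpace n) M] where
  ι : Type*
  chart : ι → OpenPartialHomeomorph M (CSpace n)
  chart_mem : ∀ k, chart k ∈ IsManifold.maximalAtlas 𝓘(ℂ, CSpace n) ω M
  cover : ∀ p : M, ∃ k, p ∈ (chart k).source
  /-- The vector field `Y k` is defined on the target of `chart k`. -/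
  Y : ι → CSpace n → CSpace n
  holomorphic : ∀ k, DifferentiableOn ℂ (Y k) (chart k).target
  codim : ∀ k, CodimAtLeastTwo {z | z ∈ (chart k).target ∧ Y k z = 0}
  compat : ∀ k l, ∃ g : CSpace n → ℂ,
    DifferentiableOn ℂ g ((chart k).symm.trans (chart l)).source ∧
    ∀ z ∈ ((chart k).symm.trans (chart l)).source, g z ≠ 0 ∧
      fderiv ℂ ((chart k).symm.trans (chart l)) z (Y k z) =
        g z • Y l ((chart k).symm.trans (chart l) z)

namespace HolFoliation

variable {n : ℕ} {M : Type*} [TopologicalSpace M] [ChartedSpace (CSpace n) M]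
  (F : HolFoliation n M)

/-- The singular set of the foliation. -/
def singularSet : Set M := {p | ∃ k, p ∈ (F.chart k).source ∧ F.Y k (F.chart k p) = 0}

/-- Foliated coordinates `φ = (x, y) : U → 𝔻 × Σ`, where `𝔻` is the unit disc of `ℂ` and `Σ` is
the unit ball of `ℂⁿ⁻¹`: a biholomorphism from an open set `U` of regular points under which
the foliation is spanned by `∂/∂x`. -/
structure IsFoliatedChart (φ : OpenPartialHomeomorph M (ℂ × CSpace (n - 1))) : Prop where
  source_subset : φ.source ⊆ F.singularSetᶜ
  target_eq : φ.target = Metric.ball 0 1 ×ˢ Metric.ball 0 1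
  holo : ContMDiffOn 𝓘(ℂ, CSpace n) 𝓘(ℂ, ℂ × CSpace (n - 1)) ω φ φ.source
  holo_symm : ContMDiffOn 𝓘(ℂ, ℂ × CSpace (n - 1)) 𝓘(ℂ, CSpace n) ω φ.symm φ.target
  tangent : ∀ k, ∀ z ∈ ((F.chart k).symm.trans φ).source,
    (fderiv ℂ ((F.chart k).symm.trans φ) z (F.Y k z)).2 = 0

/-- A path in a leaf: a continuous path in `M` that locally stays in a plaque
`{y = const}` of some foliated chart. -/
def IsLeafPath (γ : unitInterval → M) : Prop :=
  Continuous γ ∧ ∀ t, ∃ φ, F.IsFoliatedChart φ ∧ γ t ∈ φ.source ∧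
    ∀ᶠ s in 𝓝 t, (φ (γ s)).2 = (φ (γ t)).2

/-- The leaf through `p`, for a regular point `p`. -/
def leaf (p : M) : Set M := {q | ∃ γ, F.IsLeafPath γ ∧ γ 0 = p ∧ γ 1 = q}

/-- The leaves: those of the regular foliation on the complement of the singular set. -/
def IsLeaf (L : Set M) : Prop := ∃ p ∉ F.singularSet, L = F.leaf p

/-- `h` represents the holonomy germ of the loop `γ` (contained in a leaf and based at a point
`φ⁻¹(x₀, y₀)`) on the transversal `{x = x₀}`, parametrized by `y`. Namely, for `y` in a
neighbourhood `V` of `y₀`, the loop `γ` is lifted to a path `H · y` in the leaf of `φ⁻¹(x₀, y)`,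
depending continuously on `y`, starting at `φ⁻¹(x₀, y)` and ending at the point `φ⁻¹(x₀, h y)`
of the transversal. -/
def IsHolonomy (φ : OpenPartialHomeomorph M (ℂ × CSpace (n - 1))) (γ : unitInterval → M)
    (h : CSpace (n - 1) → CSpace (n - 1)) : Prop :=
  ∃ (V : Set (CSpace (n - 1))) (H : unitInterval → CSpace (n - 1) → M),
    IsOpen V ∧ (φ (γ 0)).2 ∈ V ∧ V ⊆ Metric.ball 0 1 ∧
    ContinuousOn (Function.uncurry H) (Set.univ ×ˢ V) ∧
    (∀ t, H t (φ (γ 0)).2 = γ t) ∧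
    ∀ y ∈ V, F.IsLeafPath (fun t => H t y) ∧
      H 0 y = φ.symm ((φ (γ 0)).1, y) ∧
      H 1 y ∈ φ.source ∧ φ (H 1 y) = ((φ (γ 0)).1, h y)

/-- The leaf `L` carries non-trivial holonomy: some loop in `L` has a holonomy germ different from
the germ of the identity. -/
def HasNontrivialHolonomy (L : Set M) : Prop :=
  ∃ (γ : unitInterval → M) (φ : OpenPartialHomeomorph M (ℂ × CSpace (n - 1)))
    (h : CSpace (n - 1) → CSpace (n - 1)),
    F.IsLeafPath γ ∧ γ 0 = γ 1 ∧ (∀ t, γ t ∈ L) ∧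
    F.IsFoliatedChart φ ∧ γ 0 ∈ φ.source ∧
    F.IsHolonomy φ γ h ∧ ¬ (h =ᶠ[𝓝 (φ (γ 0)).2] id)

/-- The union in `M` of the leaves carrying non-trivial holonomy. -/
def nontrivialHolonomySet : Set M :=
  ⋃₀ {L | F.IsLeaf L ∧ F.HasNontrivialHolonomy L}

end HolFoliation

/-! ### Hausdorff dimension and null sets in a complex manifold -/


/-- The subset `S` of `M` has Hausdorff dimension at most `d` (real dimension, so that `ℂⁿ` has
dimension `2n`), measured in the holomorphic charts of `M`. -/
def HausdorffDimLE (n : ℕ) {M : Type*} [TopologicalSpace M] [ChartedSpace (CSpace n) M]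
    (S : Set M) (d : ℕ) : Prop :=
  ∀ ψ ∈ IsManifold.maximalAtlas 𝓘(ℂ, CSpace n) ω M, dimH (ψ '' (ψ.source ∩ S)) ≤ d

/-- The subset `S` of `M` has Lebesgue measure zero (in the holomorphic charts of `M`). -/
def LebesgueNull (n : ℕ) {M : Type*} [TopologicalSpace M] [ChartedSpace (CSpace n) M]
    (S : Set M) : Prop :=
  ∀ ψ ∈ IsManifold.maximalAtlas 𝓘(ℂ, CSpace n) ω M,
    MeasureTheory.volume (ψ '' (ψ.source ∩ S)) = 0

/-!
The union of the leaves with non-trivial holonomy is contained in a countable union of zero sets of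
holomorphic functions, each defined on an open set and vanishing identically on no non-empty
open subset. Such a zero set has complex codimension one, hence real Hausdorff dimension at most
`2n - 2` (`AnalyticOnNhd.dimH_zeros_le`).

The holomorphic functions are differences of first integrals. Choose a countable family of foliated
charts covering the domains of all foliated charts, and cut them into boxes, each a union of plaques
over a small ball of the transversal. The transverse coordinate of a box is a first integral
of the foliation with values in `ℂⁿ⁻¹`, and it can be continued analytically along chains of boxes;
on a box, every first integral so obtained is an analytic function of the transverse coordinate of
that box (`IsContinuation`). By the identity theorem a chain determines its continuation
(`IsContinuation.eqOn`), so that only countably many first integrals arise. The `coincidenceSet`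
consists of the points at which two different ones, defined on the same box, take the same value.

Every leaf with non-trivial holonomy lies in the coincidence set. Indeed, let `f` be the transverse
coordinate at the base point of a loop with non-trivial holonomy, and let `f'` be its continuation
along the loop. Both take the same value at the base point. The continuation is constant along the
lifts of the loop to nearby leaves (`exists_isContinuation_along`), so `f' = f` near the
base point would make the holonomy germ the identity (`mem_coincidenceSet_of_isHolonomy`). Finally,
continuing both first integrals along a path in the leaf shows that the coincidence set is
saturated (`mem_coincidenceSet_iff_of_isLeafPath`).
-/

/-! ### Hausdorff dimension of zero sets of analytic functions -/

/-- A bound for the Hausdorff dimension may be checked locally. -/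
theorem dimH_le_of_forall_nhdsWithin {X : Type*} [EMetricSpace X] [SecondCountableTopology X]
    {s : Set X} {d : ENNReal} (h : ∀ x ∈ s, ∃ t ∈ 𝓝[s] x, dimH t ≤ d) : dimH s ≤ d := by
  by_contra! hlt
  obtain ⟨x, hx, hxt⟩ := exists_mem_nhdsWithin_lt_dimH_of_lt_dimH hlt
  obtain ⟨t, ht, htd⟩ := h x hx
  exact (hxt t ht).not_ge htd

section ZeroSets

variable {E : Type*} [NormedAddCommGroup E] [NormedSpace ℂ E] [FiniteDimensional ℂ E]

/-- Near a point where a complex-valued function has non-vanishing differential, its zero set is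
the image of an open subset of the kernel of the differential under a Lipschitz map. -/
theorem exists_mem_nhds_dimH_inter_zeros_le {f : E → ℂ} {f' : E →L[ℂ] ℂ} {a : E}
    (hf : HasStrictFDerivAt f f' a) (hf' : f' ≠ 0) (ha : f a = 0) :
    ∃ U ∈ 𝓝 a, dimH (U ∩ {z | f z = 0}) ≤ (2 * Module.finrank ℂ E - 2 : ℕ) := by
  have : CompleteSpace E := FiniteDimensional.complete ℂ E
  have hne : (f' : E →ₗ[ℂ] ℂ) ≠ 0 := fun h => hf' (ContinuousLinearMap.coe_injective h)
  have hrange : (f' : E →ₗ[ℂ] ℂ).range = ⊤ :=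
    LinearMap.range_eq_top.2 (LinearMap.surjective hne)
  set K := (f' : E →ₗ[ℂ] ℂ).ker with hK
  set e := HasStrictFDerivAt.implicitToOpenPartialHomeomorph f f' hf hrange with he
  obtain ⟨C, s, hs, hLip⟩ := (hf.to_implicitFunction hrange).exists_lipschitzOnWith
  have hcont : Filter.Tendsto (fun x => (e x).2) (𝓝 a) (𝓝 0) := by
    have h1 : ContinuousAt e a :=
      e.continuousAt (hf.mem_implicitToOpenPartialHomeomorph_source hrange)
    have h2 := (continuous_snd.tendsto (e a)).comp h1
    rwa [hf.implicitToOpenPartialHomeomorph_self hrange] at h2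
  refine ⟨_, Filter.inter_mem (hf.eq_implicitFunction hrange) (hcont hs), ?_⟩
  calc dimH _ ≤ dimH (HasStrictFDerivAt.implicitFunction f f' hf hrange (f a) '' s) := by
        refine dimH_mono ?_
        rintro x ⟨⟨hx, hxs⟩, hx0⟩
        refine ⟨(e x).2, hxs, ?_⟩
        have hx0' : f x = 0 := hx0
        simpa only [Set.mem_ofPred_eq, ha, hx0'] using hx
    _ ≤ dimH s := hLip.dimH_image_le
    _ ≤ dimH (Set.univ : Set K) := dimH_mono (Set.subset_univ _)
    _ = (2 * Module.finrank ℂ E - 2 : ℕ) := by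
        have : FiniteDimensional ℝ K := FiniteDimensional.complexToReal K
        rw [Real.dimH_univ_eq_finrank, finrank_real_of_complex]
        have h1 := LinearMap.finrank_range_add_finrank_ker (f' : E →ₗ[ℂ] ℂ)
        rw [hrange, finrank_top, Module.finrank_self, ← hK] at h1
        congr 1
        omega

/-- The same bound for the common zeros of the components of a vector-valued function `F`: a linear
functional reduces it to the scalar case. -/
theorem exists_mem_nhds_dimH_inter_zeros_le' {X : Type*} [NormedAddCommGroup X] [NormedSpace ℂ X]
    {F : E → X} {F' : E →L[ℂ] X} {a : E}
    (hF : HasStrictFDerivAt F F' a) (hF' : F' ≠ 0) (ha : F a = 0) :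
    ∃ U ∈ 𝓝 a, dimH (U ∩ {z | F z = 0}) ≤ (2 * Module.finrank ℂ E - 2 : ℕ) := by
  obtain ⟨v, hv⟩ : ∃ v, F' v ≠ 0 := by
    by_contra! h
    exact hF' (ContinuousLinearMap.ext h)
  obtain ⟨g, -, hg⟩ := exists_dual_vector ℂ (F' v) (norm_ne_zero_iff.2 hv)
  obtain ⟨U, hU, hd⟩ := exists_mem_nhds_dimH_inter_zeros_le (f := fun z => g (F z))
    (f' := g.comp F') (g.hasStrictFDerivAt.comp a hF)
    (fun h => by
      have := congrArg (fun L : E →L[ℂ] ℂ => L v) h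
      simp [hg, hv] at this) (by simp [ha])
  refine ⟨U, hU, (dimH_mono ?_).trans hd⟩
  rintro z ⟨hz, hz0⟩
  have hz0' : F z = 0 := hz0
  exact ⟨hz, by simp [hz0']⟩

/-- An analytic function all of whose derivatives vanish at a point vanishes near that point. -/
theorem AnalyticAt.eventuallyEq_zero_of_iteratedFDeriv_eq_zero {E : Type*}
    [NormedAddCommGroup E] [NormedSpace ℂ E] {f : E → ℂ} {a : E}
    (hf : AnalyticAt ℂ f a) (h : ∀ k, iteratedFDeriv ℂ k f a = 0) : f =ᶠ[𝓝 a] 0 := by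
  obtain ⟨p, r, hp⟩ := hf
  have hmem : ∀ᶠ y in 𝓝 a, y ∈ Metric.eball a r := Metric.eball_mem_nhds a hp.r_pos
  filter_upwards [hmem] with y hy
  have hy' : y - a ∈ Metric.eball (0 : E) r := by
    simpa [Metric.mem_eball, edist_eq_enorm_sub] using hy
  have hsum := hp.hasSum hy'
  have hzero : ∀ k, (p k fun _ => y - a) = 0 := fun k => by
    have h1 := hp.factorial_smul (y - a) k
    rw [h k, zero_apply] at h1
    exact (smul_eq_zero.1 h1).resolve_left (Nat.factorial_ne_zero k)
  simp only [hzero, add_sub_cancel] at hsum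
  exact hsum.unique hasSum_zero

/-- The zero set of a holomorphic function that vanishes identically near no point has complex
codimension one. At a zero `a`, let `k` be least such that the derivative of order `k` of `f` does
not vanish at `a`; then `a` lies on the zero set of the derivative of order `k - 1`, whose
differential at `a` does not vanish. Thus the zero set is covered by countably many sets
to which the implicit function theorem applies. -/
theorem AnalyticOnNhd.dimH_zeros_le {f : E → ℂ} {Ω : Set E} (hf : AnalyticOnNhd ℂ f Ω)
    (hne : ∀ a ∈ Ω, ¬ f =ᶠ[𝓝 a] 0) :
    dimH {z ∈ Ω | f z = 0} ≤ (2 * Module.finrank ℂ E - 2 : ℕ) := by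
  have : CompleteSpace E := FiniteDimensional.complete ℂ E
  have : SecondCountableTopology E := by
    have : FiniteDimensional ℝ E := FiniteDimensional.complexToReal E
    have := FiniteDimensional.proper ℝ E
    infer_instance
  have hsub : {z ∈ Ω | f z = 0} ⊆ ⋃ k : ℕ, {z ∈ Ω | iteratedFDeriv ℂ k f z = 0 ∧
      fderiv ℂ (iteratedFDeriv ℂ k f) z ≠ 0} := by
    rintro z ⟨hz, hz0⟩
    have hex : ∃ k, iteratedFDeriv ℂ k f z ≠ 0 := by
      by_contra! h
      exact hne z hz ((hf z hz).eventuallyEq_zero_of_iteratedFDeriv_eq_zero h)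
    classical
    have hmin : ∀ j < Nat.find hex, iteratedFDeriv ℂ j f z = 0 := fun j hj => by
      simpa using Nat.find_min hex hj
    have hspec := Nat.find_spec hex
    obtain ⟨k, hk⟩ : ∃ k, Nat.find hex = k + 1 := by
      refine Nat.exists_eq_succ_of_ne_zero fun h0 => ?_
      rw [h0] at hspec
      refine hspec ?_
      ext m
      simp [hz0]
    refine Set.mem_iUnion.2 ⟨k, hz, hmin k (by omega), fun hd => ?_⟩
    rw [hk] at hspec
    refine hspec ?_
    ext m
    simp [iteratedFDeriv_succ_apply_left, hd]
  refine (dimH_mono hsub).trans ?_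
  rw [dimH_iUnion]
  refine iSup_le fun k => dimH_le_of_forall_nhdsWithin ?_
  rintro z ⟨hz, hz0, hzd⟩
  have han : AnalyticAt ℂ (iteratedFDeriv ℂ k f) z := hf.iteratedFDeriv k z hz
  obtain ⟨U, hU, hd⟩ := exists_mem_nhds_dimH_inter_zeros_le' han.hasStrictFDerivAt hzd hz0
  refine ⟨_, Filter.inter_mem (mem_nhdsWithin_of_mem_nhds hU) self_mem_nhdsWithin,
    (dimH_mono ?_).trans hd⟩
  rintro w ⟨hw, -, hw0, -⟩
  exact ⟨hw, hw0⟩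

end ZeroSets

/-- A subset of `ℂⁿ` of Hausdorff dimension less than `2n` is Lebesgue null. -/
theorem volume_eq_zero_of_dimH_lt {n : ℕ} {s : Set (CSpace n)} (h : dimH s < (2 * n : ℕ)) :
    MeasureTheory.volume s = 0 := by
  have hfin : Module.finrank ℝ (CSpace n) = 2 * n := by
    rw [finrank_real_of_complex, finrank_euclideanSpace_fin]
  have hHaar := MeasureTheory.isAddHaarMeasure_hausdorffMeasure (E := CSpace n)
  rw [hfin] at hHaar
  refine measure_zero_of_dimH_lt (d := ((2 * n : ℕ) : NNReal)) ?_ (by exact_mod_cast h)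
  rw [NNReal.coe_natCast]
  exact MeasureTheory.Measure.absolutelyContinuous_isAddHaarMeasure _ _

/-! ### Transition maps between foliated charts -/

namespace HolFoliation

variable {n : ℕ} {M : Type*} [TopologicalSpace M] [ChartedSpace (CSpace n) M]
  {F : HolFoliation n M}

namespace IsFoliatedChart

variable {φ ψ : OpenPartialHomeomorph M (ℂ × CSpace (n - 1))}

/-- A foliated chart read in a chart of the maximal atlas is analytic. -/
theorem contDiffAt_comp_symm (hφ : F.IsFoliatedChart φ) {e : OpenPartialHomeomorph M (CSpace n)}
    (he : e ∈ IsManifold.maximalAtlas 𝓘(ℂ, CSpace n) ω M) {z : CSpace n} (hz : z ∈ e.target)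
    (hzφ : e.symm z ∈ φ.source) : ContDiffAt ℂ ω (φ ∘ e.symm) z := by
  rw [← contMDiffAt_iff_contDiffAt]
  exact ((hφ.holo _ hzφ).contMDiffAt (φ.open_source.mem_nhds hzφ)).comp z
    ((contMDiffOn_symm_of_mem_maximalAtlas he z hz).contMDiffAt (e.open_target.mem_nhds hz))

/-- A chart of the maximal atlas read in a foliated chart is analytic. -/
theorem contDiffAt_chart_comp_symm (hφ : F.IsFoliatedChart φ)
    {e : OpenPartialHomeomorph M (CSpace n)}
    (he : e ∈ IsManifold.maximalAtlas 𝓘(ℂ, CSpace n) ω M) {w : ℂ × CSpace (n - 1)}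
    (hw : w ∈ φ.target) (hwe : φ.symm w ∈ e.source) : ContDiffAt ℂ ω (e ∘ φ.symm) w := by
  rw [← contMDiffAt_iff_contDiffAt]
  exact ((contMDiffOn_of_mem_maximalAtlas he _ hwe).contMDiffAt (e.open_source.mem_nhds hwe)).comp w
    ((hφ.holo_symm w hw).contMDiffAt (φ.open_target.mem_nhds hw))

/-- The transition map between two foliated charts is analytic. -/
theorem contDiffAt_transition (hφ : F.IsFoliatedChart φ) (hψ : F.IsFoliatedChart ψ)
    {w : ℂ × CSpace (n - 1)} (hw : w ∈ φ.target) (hwψ : φ.symm w ∈ ψ.source) :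
    ContDiffAt ℂ ω (ψ ∘ φ.symm) w := by
  rw [← contMDiffAt_iff_contDiffAt]
  exact ((hψ.holo _ hwψ).contMDiffAt (ψ.open_source.mem_nhds hwψ)).comp w
    ((hφ.holo_symm w hw).contMDiffAt (φ.open_target.mem_nhds hw))

/-- The transition map between two foliated charts preserves the direction of `∂/∂x`, because
this direction is spanned by the images of the same non-vanishing vector field. -/
theorem fderiv_transition_snd (hφ : F.IsFoliatedChart φ) (hψ : F.IsFoliatedChart ψ)
    {w : ℂ × CSpace (n - 1)} (hw : w ∈ φ.target) (hwψ : φ.symm w ∈ ψ.source) :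
    (fderiv ℂ (ψ ∘ φ.symm) w (1, 0)).2 = 0 := by
  set p := φ.symm w with hp
  have hpφ : p ∈ φ.source := φ.map_target hw
  obtain ⟨k, hk⟩ := F.cover p
  set e := F.chart k with he
  set z := e p with hz
  have hzt : z ∈ e.target := e.map_source hk
  have hzp : e.symm z = p := e.left_inv hk
  have hφp : φ p = w := φ.right_inv hw
  have hY : F.Y k z ≠ 0 := fun h0 => hφ.source_subset hpφ ⟨k, hk, h0⟩
  have hnear : ∀ {χ : OpenPartialHomeomorph M (ℂ × CSpace (n - 1))}, p ∈ χ.source →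
      ∀ᶠ u in 𝓝 z, u ∈ e.target ∧ e.symm u ∈ χ.source := fun {χ} hχ =>
    (e.open_target.mem_nhds hzt |> Filter.Eventually.and <|
      (e.continuousAt_symm hzt).eventually (χ.open_source.mem_nhds (by rwa [hzp])))
  have hA : HasFDerivAt (φ ∘ e.symm) (fderiv ℂ (φ ∘ e.symm) z) z :=
    ((hφ.contDiffAt_comp_symm (F.chart_mem k) hzt (by rwa [hzp])).differentiableAt
      (by simp)).hasFDerivAt
  have hB : HasFDerivAt (ψ ∘ e.symm) (fderiv ℂ (ψ ∘ e.symm) z) z :=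
    ((hψ.contDiffAt_comp_symm (F.chart_mem k) hzt (by rwa [hzp])).differentiableAt
      (by simp)).hasFDerivAt
  have hφz : (φ ∘ e.symm) z = w := by simp [hzp, hφp]
  have hC : HasFDerivAt (e ∘ φ.symm) (fderiv ℂ (e ∘ φ.symm) w) ((φ ∘ e.symm) z) := by
    rw [hφz]
    exact ((hφ.contDiffAt_chart_comp_symm (F.chart_mem k) hw hk).differentiableAt
      (by simp)).hasFDerivAt
  have hD : HasFDerivAt (ψ ∘ φ.symm) (fderiv ℂ (ψ ∘ φ.symm) w) ((φ ∘ e.symm) z) := by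
    rw [hφz]
    exact ((hφ.contDiffAt_transition hψ hw hwψ).differentiableAt (by simp)).hasFDerivAt
  have hCA : (fderiv ℂ (e ∘ φ.symm) w).comp (fderiv ℂ (φ ∘ e.symm) z)
      = ContinuousLinearMap.id ℂ _ := by
    refine (hC.comp z hA).unique ((hasFDerivAt_id z).congr_of_eventuallyEq ?_)
    filter_upwards [hnear hpφ] with u hu
    simp [φ.left_inv hu.2, e.right_inv hu.1]
  have hDA : (fderiv ℂ (ψ ∘ φ.symm) w).comp (fderiv ℂ (φ ∘ e.symm) z)
      = fderiv ℂ (ψ ∘ e.symm) z := by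
    refine (hD.comp z hA).unique (hB.congr_of_eventuallyEq ?_)
    filter_upwards [hnear hpφ] with u hu
    simp [φ.left_inv hu.2]
  have hAY : (fderiv ℂ (φ ∘ e.symm) z (F.Y k z)).2 = 0 :=
    hφ.tangent k z (by simp [← he, hzt, hzp, hpφ])
  have hBY : (fderiv ℂ (ψ ∘ e.symm) z (F.Y k z)).2 = 0 :=
    hψ.tangent k z (by simp [← he, hzt, hzp, hwψ])
  have hAY' : fderiv ℂ (φ ∘ e.symm) z (F.Y k z) =
      (fderiv ℂ (φ ∘ e.symm) z (F.Y k z)).1 • ((1 : ℂ), (0 : CSpace (n - 1))) := by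
    ext1 <;> simp [hAY]
  have ha : (fderiv ℂ (φ ∘ e.symm) z (F.Y k z)).1 ≠ 0 := by
    intro h0
    have h1 := congrArg (fun L : CSpace n →L[ℂ] CSpace n => L (F.Y k z)) hCA
    simp only [ContinuousLinearMap.comp_apply, ContinuousLinearMap.id_apply] at h1
    rw [hAY', h0, zero_smul, map_zero] at h1
    exact hY h1.symm
  have h2 := congrArg (fun L : CSpace n →L[ℂ] ℂ × CSpace (n - 1) => (L (F.Y k z)).2) hDA
  simp only [ContinuousLinearMap.comp_apply] at h2
  rw [hBY, hAY', map_smul, Prod.smul_snd] at h2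
  exact (smul_eq_zero.1 h2).resolve_left ha

/-- Near a common point, the transverse coordinate of a foliated chart is an analytic function
of the transverse coordinate of any other foliated chart. -/
theorem exists_transverse_transition (hφ : F.IsFoliatedChart φ) (hψ : F.IsFoliatedChart ψ)
    {p : M} (hpφ : p ∈ φ.source) (hpψ : p ∈ ψ.source) :
    ∃ τ : CSpace (n - 1) → CSpace (n - 1), AnalyticAt ℂ τ (φ p).2 ∧
      ∀ᶠ z in 𝓝 p, (ψ z).2 = τ (φ z).2 := by
  set w := φ p with hw
  have hwt : w ∈ φ.target := φ.map_source hpφ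
  have hwp : φ.symm w = p := φ.left_inv hpφ
  have hnear : ∀ᶠ u in 𝓝 w, u ∈ φ.target ∧ φ.symm u ∈ ψ.source :=
    (φ.open_target.mem_nhds hwt |> Filter.Eventually.and <|
      (φ.continuousAt_symm hwt).eventually (ψ.open_source.mem_nhds (by rwa [hwp])))
  obtain ⟨r, hr, hball⟩ := Metric.eventually_nhds_iff_ball.1 hnear
  have hG : ContDiffAt ℂ ω (ψ ∘ φ.symm) w := hφ.contDiffAt_transition hψ hwt (by rwa [hwp])
  refine ⟨fun y => ((ψ ∘ φ.symm) (w.1, y)).2, ?_, ?_⟩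
  · have h1 : AnalyticAt ℂ (fun y : CSpace (n - 1) => (w.1, y)) w.2 :=
      analyticAt_const.prod analyticAt_id
    have h2 : AnalyticAt ℂ (ψ ∘ φ.symm) (w.1, w.2) := hG.analyticAt
    have h3 := h2.fun_comp h1
    exact analyticAt_snd.fun_comp h3
  · filter_upwards [φ.open_source.mem_nhds hpφ,
      (φ.continuousAt hpφ).eventually (Metric.ball_mem_nhds w hr)] with z hz hzr
    have hzr' : (φ z).1 ∈ Metric.ball w.1 r ∧ (φ z).2 ∈ Metric.ball w.2 r := by
      have hmem : φ z ∈ Metric.ball w r := hzr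
      rwa [← Prod.mk.eta (p := w), ← ball_prod_same] at hmem
    -- The transverse component of the transition map is constant along `{y = const}`.
    have hmem : ∀ x ∈ Metric.ball w.1 r, (x, (φ z).2) ∈ φ.target ∧
        φ.symm (x, (φ z).2) ∈ ψ.source := fun x hx => hball _ (by
      rw [← Prod.mk.eta (p := w), ← ball_prod_same]
      exact ⟨hx, hzr'.2⟩)
    have hderiv : ∀ x ∈ Metric.ball w.1 r,
        HasDerivAt (fun x : ℂ => ((ψ ∘ φ.symm) (x, (φ z).2)).2) 0 x := fun x hx => by
      have h1 : HasDerivAt (fun x : ℂ => (x, (φ z).2)) ((1 : ℂ), (0 : CSpace (n - 1))) x :=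
        (hasDerivAt_id x).prodMk (hasDerivAt_const x _)
      have h2 := ((hφ.contDiffAt_transition hψ (hmem x hx).1 (hmem x hx).2).differentiableAt
        (by simp)).hasFDerivAt
      have h3 := (ContinuousLinearMap.snd ℂ ℂ (CSpace (n - 1))).hasFDerivAt.comp_hasDerivAt x
        (h2.comp_hasDerivAt x h1)
      have h4 := hφ.fderiv_transition_snd hψ (hmem x hx).1 (hmem x hx).2
      simp only [ContinuousLinearMap.coe_snd', h4] at h3
      exact h3
    have hconst := Metric.isOpen_ball.is_const_of_deriv_eq_zero
      (convex_ball w.1 r).isPreconnected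
      (fun x hx => (hderiv x hx).differentiableAt.differentiableWithinAt)
      (fun x hx => (hderiv x hx).deriv) hzr'.1 (Metric.mem_ball_self hr)
    simpa [φ.left_inv hz] using hconst

end IsFoliatedChart

/-- The transverse coordinate of a foliated chart is locally constant along leaf paths. -/
theorem IsLeafPath.eventually_snd_eq {γ : unitInterval → M} (hγ : F.IsLeafPath γ)
    {φ : OpenPartialHomeomorph M (ℂ × CSpace (n - 1))} (hφ : F.IsFoliatedChart φ)
    {t : unitInterval} (ht : γ t ∈ φ.source) : ∀ᶠ s in 𝓝 t, (φ (γ s)).2 = (φ (γ t)).2 := by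
  obtain ⟨ψ, hψ, htψ, hloc⟩ := hγ.2 t
  obtain ⟨τ, -, hτ⟩ := hψ.exists_transverse_transition hφ htψ ht
  filter_upwards [hloc, hγ.1.continuousAt.eventually hτ] with s hs hsτ
  rw [hsτ, hs, hτ.self_of_nhds]

/-- The transverse coordinate of a foliated chart is constant along a portion of a leaf path
contained in the domain of the chart. -/
theorem IsLeafPath.snd_eq_of_isPreconnected {γ : unitInterval → M} (hγ : F.IsLeafPath γ)
    {φ : OpenPartialHomeomorph M (ℂ × CSpace (n - 1))} (hφ : F.IsFoliatedChart φ)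
    {J : Set unitInterval} (hJ : IsPreconnected J) (hJφ : ∀ t ∈ J, γ t ∈ φ.source)
    {s t : unitInterval} (hs : s ∈ J) (ht : t ∈ J) : (φ (γ s)).2 = (φ (γ t)).2 :=
  hJ.induction₂ (fun s t => (φ (γ s)).2 = (φ (γ t)).2)
    (fun t ht => nhdsWithin_le_nhds <|
      (hγ.eventually_snd_eq hφ (hJφ t ht)).mono fun _ h => h.symm)
    (fun _ _ _ _ _ _ => Eq.trans) (fun _ _ _ _ => Eq.symm) hs ht

end HolFoliation

/-! ### Analytic continuation of transverse coordinates -/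

/-- The balls of radius `1 / (m + 1)` centred at the points of a dense sequence: a countable basis
of the topology of the transversal `ℂᵈ` that consists of connected sets. -/
noncomputable def transverseBall (d : ℕ) (k : ℕ × ℕ) : Set (CSpace d) :=
  Metric.ball (TopologicalSpace.denseSeq (CSpace d) k.1) (1 / (k.2 + 1 : ℝ))

theorem isOpen_transverseBall (d : ℕ) (k : ℕ × ℕ) : IsOpen (transverseBall d k) :=
  Metric.isOpen_ball

theorem isPreconnected_transverseBall (d : ℕ) (k : ℕ × ℕ) : IsPreconnected (transverseBall d k) :=
  (convex_ball _ _).isPreconnected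

theorem exists_mem_transverseBall_subset {d : ℕ} {y : CSpace d} {U : Set (CSpace d)}
    (hU : U ∈ 𝓝 y) : ∃ k, y ∈ transverseBall d k ∧ transverseBall d k ⊆ U := by
  obtain ⟨ε, hε, hεU⟩ := Metric.mem_nhds_iff.1 hU
  obtain ⟨m, hm⟩ := exists_nat_one_div_lt (half_pos hε)
  obtain ⟨j, hj⟩ := (TopologicalSpace.denseRange_denseSeq (CSpace d)).exists_dist_lt y
    (Nat.one_div_pos_of_nat (α := ℝ) (n := m))
  refine ⟨(j, m), hj, fun x hx => hεU ?_⟩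
  have hx' : dist x (TopologicalSpace.denseSeq (CSpace d) j) < 1 / (m + 1 : ℝ) := hx
  rw [Metric.mem_ball]
  linarith [dist_triangle_right x y (TopologicalSpace.denseSeq (CSpace d) j)]

/-- The transverse coordinate of a chart with values in a product is an open map. -/
theorem OpenPartialHomeomorph.map_nhds_snd {X A B : Type*} [TopologicalSpace X]
    [TopologicalSpace A] [TopologicalSpace B] (φ : OpenPartialHomeomorph X (A × B)) {p : X}
    (hp : p ∈ φ.source) : Filter.map (fun z => (φ z).2) (𝓝 p) = 𝓝 (φ p).2 := by
  rw [← map_snd_nhds, ← φ.map_nhds_eq hp, Filter.map_map]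
  rfl

namespace HolFoliation

variable {n : ℕ} {M : Type*} [TopologicalSpace M] [ChartedSpace (CSpace n) M]

/-- A countable family of foliated charts whose domains cover all points that lie in the domain of
some foliated chart. Leaf paths run through such points by definition, so that the existence of
flow boxes around all regular points plays no role. -/
structure CountableFoliatedCover (F : HolFoliation n M) where
  /-- The charts of the family. -/
  charts : Set (OpenPartialHomeomorph M (ℂ × CSpace (n - 1)))
  countable : charts.Countable
  foliated : ∀ φ ∈ charts, F.IsFoliatedChart φ
  covers : ∀ φ, F.IsFoliatedChart φ → ∀ p ∈ φ.source, ∃ ψ ∈ charts, p ∈ ψ.source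

theorem nonempty_countableFoliatedCover [SecondCountableTopology M] (F : HolFoliation n M) :
    Nonempty F.CountableFoliatedCover := by
  obtain ⟨T, hTs, hTc, hT⟩ := TopologicalSpace.isOpen_biUnion_countable
    {φ | F.IsFoliatedChart φ} (fun φ => φ.source) (fun φ _ => φ.open_source)
  refine ⟨⟨T, hTc, fun φ hφ => hTs hφ, fun φ hφ p hp => ?_⟩⟩
  have hmem : p ∈ ⋃ φ ∈ {φ | F.IsFoliatedChart φ}, φ.source := Set.mem_biUnion hφ hp
  rw [← hT] at hmem
  simpa using hmem

namespace CountableFoliatedCover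

variable {F : HolFoliation n M} (A : F.CountableFoliatedCover)

/-- A box is a chart of the family together with an element of the basis of the transversal. -/
abbrev Box : Type _ := A.charts × (ℕ × ℕ)

variable {A}

/-- The transverse coordinate of the chart of a box. -/
noncomputable def Box.proj (b : A.Box) (z : M) : CSpace (n - 1) := (b.1.1 z).2

/-- The range of the transverse coordinate of a box. -/
noncomputable def Box.base (b : A.Box) : Set (CSpace (n - 1)) := transverseBall (n - 1) b.2

/-- The open subset of `M` formed by the plaques that a box consists of. -/
def Box.carrier (b : A.Box) : Set M := {z ∈ b.1.1.source | b.proj z ∈ b.base}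

theorem Box.map_nhds_proj (b : A.Box) {p : M} (hp : p ∈ b.1.1.source) :
    Filter.map b.proj (𝓝 p) = 𝓝 (b.proj p) :=
  b.1.1.map_nhds_snd hp

theorem Box.continuousAt_proj (b : A.Box) {p : M} (hp : p ∈ b.1.1.source) :
    ContinuousAt b.proj p :=
  (b.map_nhds_proj hp).le

theorem Box.isPreconnected_base (b : A.Box) : IsPreconnected b.base :=
  isPreconnected_transverseBall _ _

theorem Box.carrier_mem_nhds (b : A.Box) {p : M} (hp : p ∈ b.carrier) : b.carrier ∈ 𝓝 p :=
  Filter.inter_mem (b.1.1.open_source.mem_nhds hp.1)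
    ((b.continuousAt_proj hp.1).preimage_mem_nhds ((isOpen_transverseBall _ _).mem_nhds hp.2))

/-- Two analytic functions of the transverse coordinate of a box that agree near a point of the
box agree everywhere. -/
theorem eqOn_base_of_eventually {b : A.Box} {X : Type*} [NormedAddCommGroup X]
    [NormedSpace ℂ X] {f g : CSpace (n - 1) → X} (hf : AnalyticOnNhd ℂ f b.base) (hg : AnalyticOnNhd ℂ g b.base)
    {p : M} (hp : p ∈ b.carrier) (h : ∀ᶠ z in 𝓝 p, f (b.proj z) = g (b.proj z)) :
    Set.EqOn f g b.base := by
  refine hf.eqOn_of_preconnected_of_eventuallyEq hg b.isPreconnected_base hp.2 ?_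
  rw [Filter.EventuallyEq, ← b.map_nhds_proj hp.1, Filter.eventually_map]
  exact h

/-- `A.IsContinuation l b u` says that the first integral `u ∘ b.proj` on the box `b` arises, by
analytic continuation along the chain of boxes `l` (listed backwards, without `b`), from the
transverse coordinate of the box where the chain starts. Two consecutive boxes come with an
element of a countable basis of `M`, contained in both, on which the first integrals are required
to agree. -/
noncomputable def IsContinuation [SecondCountableTopology M] (A : F.CountableFoliatedCover) :
    List (A.Box × TopologicalSpace.countableBasis M) → A.Box →
      (CSpace (n - 1) → CSpace (n - 1)) → Prop
  | [], b, u => Set.EqOn u id b.base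
  | (a, O) :: l, b, u => AnalyticOnNhd ℂ u b.base ∧ ∃ v, A.IsContinuation l a v ∧
      (O : Set M) ⊆ a.carrier ∩ b.carrier ∧ ∀ z ∈ (O : Set M), v (a.proj z) = u (b.proj z)

variable [SecondCountableTopology M]
  {l l' : List (A.Box × TopologicalSpace.countableBasis M)} {b : A.Box}
  {u u' : CSpace (n - 1) → CSpace (n - 1)}

theorem IsContinuation.analyticOnNhd (h : A.IsContinuation l b u) : AnalyticOnNhd ℂ u b.base := by
  match l, h with
  | [], h => exact analyticOnNhd_id.congr (isOpen_transverseBall _ _) (Set.EqOn.symm h)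
  | (_, _) :: _, h => exact h.1

/-- Continuation along a given chain of boxes has at most one result. -/
theorem IsContinuation.eqOn (h : A.IsContinuation l b u) (h' : A.IsContinuation l b u') :
    Set.EqOn u u' b.base := by
  induction l generalizing b u u' with
  | nil => exact Set.EqOn.trans h (Set.EqOn.symm h')
  | cons c l ih =>
    obtain ⟨a, O⟩ := c
    obtain ⟨hu, v, hv, hO, hvu⟩ := h
    obtain ⟨hu', v', hv', -, hvu'⟩ := h'
    obtain ⟨p, hp⟩ := TopologicalSpace.nonempty_of_mem_countableBasis O.2
    have hOo := TopologicalSpace.isOpen_of_mem_countableBasis O.2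
    refine eqOn_base_of_eventually hu hu' (hO hp).2 ?_
    filter_upwards [hOo.mem_nhds hp] with z hz
    rw [← hvu z hz, ← hvu' z hz, ih hv hv' (hO hz).1.2]

/-- A first integral obtained by continuation extends, from a neighbourhood of a point, to the whole
plaques of every small enough box around that point. -/
theorem IsContinuation.exists_extension (h : A.IsContinuation l b u)
    {p : M} (hp : p ∈ b.carrier) (ψ : A.charts) (hpψ : p ∈ ψ.1.source) :
    ∃ N ∈ 𝓝 (ψ.1 p).2, ∀ k, (ψ.1 p).2 ∈ transverseBall (n - 1) k →
      transverseBall (n - 1) k ⊆ N → ∃ l' v, A.IsContinuation l' (ψ, k) v ∧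
        ∀ᶠ z in 𝓝 p, v (ψ.1 z).2 = u (b.proj z) := by
  obtain ⟨τ, hτ, hτz⟩ := (A.foliated _ ψ.2).exists_transverse_transition
    (A.foliated _ b.1.2) hpψ hp.1
  have hτp : b.proj p = τ (ψ.1 p).2 := hτz.self_of_nhds
  have hv : AnalyticAt ℂ (u ∘ τ) (ψ.1 p).2 :=
    AnalyticAt.comp (by rw [← hτp]; exact h.analyticOnNhd _ hp.2) hτ
  refine ⟨_, hv.eventually_analyticAt, fun k hk hkN => ?_⟩
  have hnhds : {z | z ∈ b.carrier ∩ Box.carrier (A := A) (ψ, k) ∧ b.proj z = τ (ψ.1 z).2} ∈ 𝓝 p :=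
    Filter.inter_mem (Filter.inter_mem (b.carrier_mem_nhds hp)
      (Box.carrier_mem_nhds (A := A) (ψ, k) ⟨hpψ, hk⟩)) hτz
  obtain ⟨O, hOB, hpO, hO⟩ :=
    (TopologicalSpace.isBasis_countableBasis M).mem_nhds_iff.1 hnhds
  refine ⟨(b, ⟨O, hOB⟩) :: l, u ∘ τ, ⟨fun y hy => hkN hy, u, h, fun z hz => (hO hz).1,
    fun z hz => ?_⟩, ?_⟩
  · rw [(hO hz).2]
    rfl
  · filter_upwards [hτz] with z hz
    exact congrArg u hz.symm

variable (A) in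
/-- The points at which two different continuations of transverse coordinates, defined on the same
box, take the same value. -/
def coincidenceSet : Set M :=
  {p | ∃ (l l' : List (A.Box × TopologicalSpace.countableBasis M)) (b : A.Box)
    (u u' : CSpace (n - 1) → CSpace (n - 1)), A.IsContinuation l b u ∧ A.IsContinuation l' b u' ∧
      p ∈ b.carrier ∧ u (b.proj p) = u' (b.proj p) ∧ ¬ Set.EqOn u u' b.base}

theorem mem_coincidenceSet_of_snd_eq {p q : M}
    (hp : p ∈ A.coincidenceSet) (ψ : A.charts) (hpψ : p ∈ ψ.1.source) (hqψ : q ∈ ψ.1.source)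
    (hpq : (ψ.1 q).2 = (ψ.1 p).2) : q ∈ A.coincidenceSet := by
  obtain ⟨l, l', b, u, u', hu, hu', hpb, heq, hne⟩ := hp
  obtain ⟨N, hN, hext⟩ := hu.exists_extension hpb ψ hpψ
  obtain ⟨N', hN', hext'⟩ := hu'.exists_extension hpb ψ hpψ
  obtain ⟨k, hk, hkN⟩ := exists_mem_transverseBall_subset (Filter.inter_mem hN hN')
  obtain ⟨m, v, hv, hvz⟩ := hext k hk fun y hy => (hkN hy).1
  obtain ⟨m', v', hv', hvz'⟩ := hext' k hk fun y hy => (hkN hy).2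
  refine ⟨m, m', (ψ, k), v, v', hv, hv', ⟨hqψ, ?_⟩, ?_, fun hvv => hne ?_⟩
  · exact Set.mem_of_eq_of_mem hpq hk
  · change v (ψ.1 q).2 = v' (ψ.1 q).2
    rw [hpq, hvz.self_of_nhds, hvz'.self_of_nhds, heq]
  · refine eqOn_base_of_eventually hu.analyticOnNhd hu'.analyticOnNhd hpb ?_
    filter_upwards [hvz, hvz', Box.carrier_mem_nhds (A := A) (ψ, k) ⟨hpψ, hk⟩] with z hz hz' hzb
    rw [← hz, ← hz']
    exact hvv hzb.2

/-- The coincidence set is saturated by the leaves. -/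
theorem mem_coincidenceSet_iff_of_isLeafPath {γ : unitInterval → M} (hγ : F.IsLeafPath γ) (s t : unitInterval) :
    γ s ∈ A.coincidenceSet ↔ γ t ∈ A.coincidenceSet := by
  refine isPreconnected_univ.induction₂
    (fun s t => γ s ∈ A.coincidenceSet ↔ γ t ∈ A.coincidenceSet) (fun t _ => ?_)
    (fun _ _ _ _ _ _ => Iff.trans) (fun _ _ _ _ => Iff.symm) (Set.mem_univ s) (Set.mem_univ t)
  obtain ⟨φ, hφ, htφ, -⟩ := hγ.2 t
  obtain ⟨ψ, hψ, htψ⟩ := A.covers φ hφ _ htφ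
  rw [nhdsWithin_univ]
  filter_upwards [hγ.eventually_snd_eq (A.foliated ψ hψ) htψ,
    hγ.1.continuousAt.eventually (ψ.open_source.mem_nhds htψ)] with s hs hsψ
  exact ⟨fun h => mem_coincidenceSet_of_snd_eq h ⟨ψ, hψ⟩ htψ hsψ hs,
    fun h => mem_coincidenceSet_of_snd_eq h ⟨ψ, hψ⟩ hsψ htψ hs.symm⟩

/-- Continuation along a family of leaf paths. Let `H · y` be leaf paths that depend
continuously on `y` near `y₀`, and let `g` be a function of the parameter `y`. If some
continuation takes the values `g y` at the points `H s y` for `y` close to `y₀`,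
then some continuation takes these values at the points `H t y`. -/
theorem exists_isContinuation_along {V : Set (CSpace (n - 1))} {y₀ : CSpace (n - 1)} {H : unitInterval → CSpace (n - 1) → M}
    (hV : V ∈ 𝓝 y₀) (hH : ContinuousOn (Function.uncurry H) (Set.univ ×ˢ V))
    (hleaf : ∀ y ∈ V, F.IsLeafPath fun t => H t y) (g : CSpace (n - 1) → CSpace (n - 1))
    (s t : unitInterval)
    (hs : ∃ l b u, A.IsContinuation l b u ∧ H s y₀ ∈ b.carrier ∧
      ∀ᶠ y in 𝓝 y₀, u (b.proj (H s y)) = g y) :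
    ∃ l b u, A.IsContinuation l b u ∧ H t y₀ ∈ b.carrier ∧
      ∀ᶠ y in 𝓝 y₀, u (b.proj (H t y)) = g y := by
  set P : unitInterval → Prop := fun t => ∃ l b u, A.IsContinuation l b u ∧
    H t y₀ ∈ b.carrier ∧ ∀ᶠ y in 𝓝 y₀, u (b.proj (H t y)) = g y with hP
  have hcont : ∀ t, ContinuousAt (Function.uncurry H) (t, y₀) := fun t =>
    hH.continuousAt (prod_mem_nhds Filter.univ_mem hV)
  have hcont' : ∀ t, ContinuousAt (H t) y₀ := fun t =>
    (hcont t).comp (f := fun y => (t, y)) (by fun_prop)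
  suffices h : P s ↔ P t from h.1 hs
  refine isPreconnected_univ.induction₂ (fun s t => P s ↔ P t) (fun t _ => ?_)
    (fun _ _ _ _ _ _ => Iff.trans) (fun _ _ _ _ => Iff.symm) (Set.mem_univ s) (Set.mem_univ t)
  rw [nhdsWithin_univ]
  obtain ⟨φ, hφ, htφ, -⟩ := (hleaf y₀ (mem_of_mem_nhds hV)).2 t
  obtain ⟨ψ, hψ, htψ⟩ := A.covers φ hφ _ htφ
  -- On a connected neighbourhood `J` of `t`, uniformly for `y` close to `y₀`, the paths stay in the
  -- domain of `ψ`, hence in plaques of `ψ`.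
  obtain ⟨pa, hpa, pb, hpb, hab⟩ := Filter.eventually_prod_iff.1
    (show ∀ᶠ x in 𝓝 t ×ˢ 𝓝 y₀, Function.uncurry H x ∈ ψ.source by
      rw [← nhds_prod_eq]
      exact (hcont t).eventually (ψ.open_source.mem_nhds htψ))
  obtain ⟨J, hJ, hJt, hJc⟩ : ∃ J : Set unitInterval, (∀ s ∈ J, pa s) ∧ J ∈ 𝓝 t ∧
      IsPreconnected J := by
    obtain ⟨ε, hε, hJ⟩ := Metric.mem_nhds_iff.1 hpa
    refine ⟨Metric.ball t ε, hJ, Metric.ball_mem_nhds t hε, Set.OrdConnected.isPreconnected ?_⟩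
    refine ⟨fun r hr r' hr' x hx => ?_⟩
    simp only [Metric.mem_ball, Subtype.dist_eq, Real.dist_eq, abs_lt] at hr hr' ⊢
    have h1 : (r : ℝ) ≤ x := hx.1
    have h2 : (x : ℝ) ≤ r' := hx.2
    constructor <;> linarith
  have hplaque : ∀ᶠ y in 𝓝 y₀, ∀ s ∈ J, ∀ s' ∈ J, (ψ (H s y)).2 = (ψ (H s' y)).2 := by
    filter_upwards [hV, hpb] with y hyV hy s hs s' hs'
    exact (hleaf y hyV).snd_eq_of_isPreconnected (A.foliated ψ hψ) hJc
      (fun r hr => hab (hJ r hr) hy) hs hs'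
  have hstep : ∀ s ∈ J, ∀ s' ∈ J, P s → P s' := by
    rintro s hs s' hs' ⟨l, b, u, hu, hsb, hval⟩
    have hsψ : ∀ r ∈ J, H r y₀ ∈ ψ.source := fun r hr => hab (hJ r hr) hpb.self_of_nhds
    obtain ⟨N, hN, hext⟩ := hu.exists_extension hsb ⟨ψ, hψ⟩ (hsψ s hs)
    obtain ⟨k, hk, hkN⟩ := exists_mem_transverseBall_subset hN
    obtain ⟨m, v, hv, hvz⟩ := hext k hk hkN
    refine ⟨m, (⟨ψ, hψ⟩, k), v, hv, ⟨hsψ s' hs', ?_⟩, ?_⟩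
    · exact Set.mem_of_eq_of_mem (hplaque.self_of_nhds s' hs' s hs) hk
    · filter_upwards [hplaque, hval, (hcont' s).eventually hvz] with y hy hyg hyv
      change v (ψ (H s' y)).2 = g y
      rw [hy s' hs' s hs, ← hyg]
      exact hyv
  filter_upwards [hJt] with s hs
  exact ⟨hstep t (mem_of_mem_nhds hJt) s hs, hstep s hs t (mem_of_mem_nhds hJt)⟩

/-- The base point of a loop with non-trivial holonomy lies in the coincidence set: the continuation
of a transverse coordinate along the loop takes the same value there as the transverse coordinate,
and if the two agreed near the base point, the holonomy would be the identity. -/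
theorem mem_coincidenceSet_of_isHolonomy {φ : OpenPartialHomeomorph M (ℂ × CSpace (n - 1))} {γ : unitInterval → M}
    {h : CSpace (n - 1) → CSpace (n - 1)} (hloop : γ 0 = γ 1) (hφ : F.IsFoliatedChart φ)
    (hγφ : γ 0 ∈ φ.source) (hol : F.IsHolonomy φ γ h) (hne : ¬ h =ᶠ[𝓝 (φ (γ 0)).2] id) :
    γ 0 ∈ A.coincidenceSet := by
  obtain ⟨V, H, hVo, hyV, -, hH, hHγ, hHy⟩ := hol
  set y₀ := (φ (γ 0)).2 with hy₀
  have hV : V ∈ 𝓝 y₀ := hVo.mem_nhds hyV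
  obtain ⟨ψ, hψ, hγψ⟩ := A.covers φ hφ _ hγφ
  have hcont : ∀ t, ContinuousAt (H t) y₀ := fun t =>
    (hH.continuousAt (x := (t, y₀)) (prod_mem_nhds Filter.univ_mem hV)).comp
      (f := fun y => (t, y)) (by fun_prop)
  have hlim0 : Filter.Tendsto (H 0) (𝓝 y₀) (𝓝 (γ 0)) := by
    simpa only [ContinuousAt, hHγ] using hcont 0
  have hlim1 : Filter.Tendsto (H 1) (𝓝 y₀) (𝓝 (γ 0)) := by
    simpa only [ContinuousAt, hHγ, ← hloop] using hcont 1
  obtain ⟨k₀, hk₀, -⟩ := exists_mem_transverseBall_subset (y := (ψ (γ 0)).2) Filter.univ_mem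
  obtain ⟨l, b, u, hu, hb, hval⟩ := exists_isContinuation_along (A := A) hV hH
    (fun y hy => (hHy y hy).1) (fun y => (ψ (H 0 y)).2) 0 1
    ⟨[], (⟨ψ, hψ⟩, k₀), id, Set.eqOn_refl _ _, by rw [hHγ]; exact ⟨hγψ, hk₀⟩,
      Filter.Eventually.of_forall fun y => rfl⟩
  rw [hHγ, ← hloop] at hb
  obtain ⟨N, hN, hext⟩ := hu.exists_extension hb ⟨ψ, hψ⟩ hγψ
  obtain ⟨k, hk, hkN⟩ := exists_mem_transverseBall_subset hN
  obtain ⟨m, v, hv, hvz⟩ := hext k hk hkN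
  have hvH : ∀ᶠ y in 𝓝 y₀, v (ψ (H 1 y)).2 = (ψ (H 0 y)).2 := by
    filter_upwards [hval, hlim1.eventually hvz] with y hy hyv
    rw [← hy]
    exact hyv
  refine ⟨m, [], (⟨ψ, hψ⟩, k), v, id, hv, Set.eqOn_refl _ _, ⟨hγψ, hk⟩, ?_, fun heq => hne ?_⟩
  · have := hvH.self_of_nhds
    rwa [hHγ, hHγ, ← hloop] at this
  · obtain ⟨τ, -, hτ⟩ := (A.foliated ψ hψ).exists_transverse_transition hφ hγψ hγφ
    have htarget : ∀ᶠ y in 𝓝 y₀, ((φ (γ 0)).1, y) ∈ φ.target :=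
      (Continuous.prodMk_right (φ (γ 0)).1).continuousAt.eventually
        (φ.open_target.mem_nhds (φ.map_source hγφ))
    filter_upwards [hvH, htarget, hV, hlim0.eventually hτ, hlim1.eventually hτ,
      hlim1.eventually (Box.carrier_mem_nhds (A := A) (⟨ψ, hψ⟩, k) ⟨hγψ, hk⟩)]
      with y hy hyt hyV' hτ0 hτ1 hbox
    obtain ⟨-, hH0, -, hH1⟩ := hHy y hyV'
    have hv1 : v (ψ (H 1 y)).2 = (ψ (H 1 y)).2 := heq hbox.2
    rw [hv1] at hy
    rw [hy, ← hτ0, hH1, hH0, φ.right_inv hyt] at hτ1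
    exact hτ1

theorem nontrivialHolonomySet_subset :
    F.nontrivialHolonomySet ⊆ A.coincidenceSet := by
  rintro q ⟨L, ⟨⟨p, -, rfl⟩, γ, φ, h, -, hloop, hmem, hφ, hγφ, hol, hne⟩, σ, hσ, hσ0, hσ1⟩
  obtain ⟨ρ, hρ, hρ0, hρ1⟩ := hmem 0
  have h0 : γ 0 ∈ A.coincidenceSet := mem_coincidenceSet_of_isHolonomy hloop hφ hγφ hol hne
  rw [← hρ1, ← mem_coincidenceSet_iff_of_isLeafPath hρ 0 1, hρ0, ← hσ0,
    mem_coincidenceSet_iff_of_isLeafPath hσ 0 1, hσ1] at h0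
  exact h0

/-! ### The dimension of the coincidence set -/

/-- For given chains of boxes, the points where two different continuations coincide form
the zero set of a holomorphic function that vanishes identically on no open set. -/
theorem dimH_image_coincidence_le (hu : A.IsContinuation l b u) (hu' : A.IsContinuation l' b u')
    (hne : ¬ Set.EqOn u u' b.base) {e : OpenPartialHomeomorph M (CSpace n)}
    (he : e ∈ IsManifold.maximalAtlas 𝓘(ℂ, CSpace n) ω M) :
    dimH (e '' (e.source ∩ {p ∈ b.carrier | u (b.proj p) = u' (b.proj p)})) ≤
      (2 * n - 2 : ℕ) := by
  obtain ⟨y, hy, i, hi⟩ : ∃ y ∈ b.base, ∃ i, u y i ≠ u' y i := by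
    by_contra! hcon
    exact hne fun y hy => PiLp.ext (hcon y hy)
  have hcomp : ∀ {f : CSpace (n - 1) → CSpace (n - 1)}, AnalyticOnNhd ℂ f b.base →
      AnalyticOnNhd ℂ (fun y => f y i) b.base := fun hf y hy =>
    ((EuclideanSpace.proj i : CSpace (n - 1) →L[ℂ] ℂ).analyticAt _).comp (hf y hy)
  have hd := AnalyticOnNhd.dimH_zeros_le
    (f := fun w => u (b.proj (e.symm w)) i - u' (b.proj (e.symm w)) i)
    (Ω := {w ∈ e.target | e.symm w ∈ b.carrier})
    (fun w hw => by
      have hproj : AnalyticAt ℂ (fun w => b.proj (e.symm w)) w :=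
        analyticAt_snd.comp ((A.foliated _ b.1.2).contDiffAt_comp_symm he hw.1 hw.2.1).analyticAt
      exact AnalyticAt.sub
        (AnalyticAt.comp (g := fun y => u y i) (hcomp hu.analyticOnNhd _ hw.2.2) hproj)
        (AnalyticAt.comp (g := fun y => u' y i) (hcomp hu'.analyticOnNhd _ hw.2.2) hproj))
    (fun w hw hzero => by
      have hcont := e.continuousAt (e.map_target hw.1)
      rw [ContinuousAt, e.right_inv hw.1] at hcont
      refine hi (eqOn_base_of_eventually (hcomp hu.analyticOnNhd) (hcomp hu'.analyticOnNhd)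
        hw.2 ?_ hy)
      filter_upwards [hcont.eventually hzero, e.open_source.mem_nhds (e.map_target hw.1)]
        with z hz hze
      rw [e.left_inv hze] at hz
      exact sub_eq_zero.1 hz)
  rw [finrank_euclideanSpace_fin] at hd
  refine (dimH_mono ?_).trans hd
  rintro _ ⟨p, ⟨hpe, hpb, hp⟩, rfl⟩
  refine ⟨⟨e.map_source hpe, ?_⟩, ?_⟩
  · rwa [e.left_inv hpe]
  · rw [e.left_inv hpe, hp, sub_self]

theorem hausdorffDimLE_coincidenceSet :
    HausdorffDimLE n A.coincidenceSet (2 * n - 2) := by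
  intro e he
  have : Countable A.charts := A.countable.to_subtype
  have : Countable (TopologicalSpace.countableBasis M) :=
    (TopologicalSpace.countable_countableBasis M).to_subtype
  set Z : List (A.Box × TopologicalSpace.countableBasis M) ×
      List (A.Box × TopologicalSpace.countableBasis M) × A.Box → Set M := fun c =>
    {p ∈ c.2.2.carrier | ∃ u u', A.IsContinuation c.1 c.2.2 u ∧ A.IsContinuation c.2.1 c.2.2 u' ∧
      u (c.2.2.proj p) = u' (c.2.2.proj p) ∧ ¬ Set.EqOn u u' c.2.2.base} with hZ
  have hsub : e '' (e.source ∩ A.coincidenceSet) ⊆ ⋃ c, e '' (e.source ∩ Z c) := by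
    rintro _ ⟨p, ⟨hpe, l, l', b, u, u', hu, hu', hpb, heq, hne⟩, rfl⟩
    exact Set.mem_iUnion.2 ⟨(l, l', b), p, ⟨hpe, hpb, u, u', hu, hu', heq, hne⟩, rfl⟩
  refine (dimH_mono hsub).trans ?_
  rw [dimH_iUnion]
  refine iSup_le fun ⟨l, l', b⟩ => ?_
  rcases (Z (l, l', b)).eq_empty_or_nonempty with hempty | ⟨q, -, u, u', hu, hu', -, hne⟩
  · simp [hempty]
  · refine (dimH_mono (Set.image_mono (Set.inter_subset_inter_right _ ?_))).trans
      (dimH_image_coincidence_le hu hu' hne he)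
    -- By uniqueness of the continuation, all the points of `Z` come from the same pair `u, u'`.
    rintro p ⟨hpb, v, v', hv, hv', heq, -⟩
    exact ⟨hpb, by rw [hu.eqOn hv hpb.2, hu'.eqOn hv' hpb.2, heq]⟩

end CountableFoliatedCover

end HolFoliation

theorem mainTheorem8 (n : ℕ) (hn : 1 ≤ n) (M : Type*) [TopologicalSpace M] [T2Space M]
    [SecondCountableTopology M] [ChartedSpace (CSpace n) M]
    [IsManifold 𝓘(ℂ, CSpace n) ω M] (hM : IsKahler n M) (F : HolFoliation n M) :
    HausdorffDimLE n F.nontrivialHolonomySet (2 * n - 2) ∧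
      LebesgueNull n F.nontrivialHolonomySet := by
  obtain ⟨A⟩ := F.nonempty_countableFoliatedCover
  have hdim : HausdorffDimLE n F.nontrivialHolonomySet (2 * n - 2) := fun e he =>
    (dimH_mono (Set.image_mono (Set.inter_subset_inter_right _
      A.nontrivialHolonomySet_subset))).trans (A.hausdorffDimLE_coincidenceSet e he)
  refine ⟨hdim, fun e he => volume_eq_zero_of_dimH_lt ((hdim e he).trans_lt ?_)⟩
  exact_mod_cast (by omega : 2 * n - 2 < 2 * n)
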